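/- **Proposition 4.5.** Let $N\ge 2$ and $k\ge 1$ be integers. Let $P_+^k$ be the set of weights $\lambda=\sum_{i=1}^{N-1}\lambda_i\Lambda_i$ of $\mathfrak{sl}_N$ with integers $\lambda_i\ge 0$ and $\sum_{i=1}^{N-1}\lambda_i\le k$ (they label the simple objects $V_\lambda$ of $\mathcal C(\mathfrak{sl}_N,k)$), and put $\lambda_0=k-\sum_{i=1}^{N-1}\lambda_i$ and $t(\lambda)=\sum_{i=1}^{N-1} i\lambda_i$. Reading indices modulo $N$, let $\tau(\lambda)$ be the weight with $\tau(\lambda)_i=\lambda_{i-1}$ and $\lambda^*$ the dual weight, $(\lambda^*)_i=\lambda_{-i}$. Put $\hat k=k+N$ if $Nk$ is odd and $\hat k=k$ otherwise. Call $d$ *admissible* if $d\mid \frac N2$ in the case that $N$ is even and $k$ is odd, and if $d\mid N$ otherwise. For admissible $d$, the modular invariant $Z(d,+)$ of the simple current module category $\mathcal M_{d,+}$ is the matrix indexed by $P_+^k$ with entries $$Z(d,+)_{\lambda,\nu}=\sum_{i=1}^{d}\delta^d\!\left(t(\lambda)+\frac{Ni\hat k}{2d}\right)\delta_{\nu,\tau^{iN/d}(\lambda)},$$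 where $\delta^d(L)=1$ if $d\mid L$ and $\delta^d(L)=0$ otherwise. The charge conjugation modular invariant is $Z(1,-)_{\lambda,\nu}=\delta_{\lambda,\nu^*}$. Let $m_d=\gcd(d,Nk/d)$ if $N$ is odd and $m_d=\gcd(d,Nk/(2d))$ if $N$ is even. Let $v_p(n)$ be the exponent of $p$ in $n$. For primes $p\mid N$ let $\vec a(d)_p=+1$ if $v_p(d)=v_p(m_d)$ and $\vec a(d)_p=-1$ otherwise. For $\vec a,\vec b\in\{+1,-1\}^{\{p\,:\,p\mid N\}}$ write $\vec a\sim_m\vec b$ if $\vec a_p=\vec b_p$ for every prime $p\mid N$ with $v_p(k)\le v_p(m)+e_p$ and $2v_p(m)+e_p<v_p(N)+v_p(k)$, where $e_2=1$ and $e_p=0$ for odd $p$. Then: 1. $Z(1,-)^2=Z(1,+)$. 2. $Z(1,-)\,Z(d,+)=Z(d,+)\,Z(1,-)$ for every admissible $d$. 3. For all admissible $d',d''$ there is exactly one admissible $d$ with $m_d=\operatorname{lcm}(m_{d'},m_{d''})$ and $\vec a(d)\sim_{m_d}\vec a(d')\,\vec a(d'')$ (componentwise product), and for this $d$ $$Z(d',+)\,Z(d'',+)=Z(d'',+)\,Z(d',+)=\gcd(m_{d'},m_{d''})\,Z(d,+).$$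 -/

import Mathlib

namespace SLModInv

/-- The set `P_+^k(sl_N)` of level `k` dominant integral weights of `sl_N`, which indexes the simple
objects of `C(sl_N, k)`. A weight `∑_{i=1}^{N-1} λ_i Λ_i` with `λ_1 + ... + λ_{N-1} ≤ k` is recorded
together with its zeroth (affine) label `λ_0 = k - (λ_1 + ... + λ_{N-1}) ≥ 0`; the labels
`λ_0, ..., λ_{N-1}` are indexed by `ℤ/N` and add up to `k`. -/
abbrev Weight (N k : ℕ) [NeZero N] : Type :=
  {l : ZMod N → ℕ // ∑ i, l i = k}

instance (N k : ℕ) [NeZero N] : Fintype (Weight N k) :=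
  Fintype.subtype (Finset.piAntidiag Finset.univ k) (by simp)

section
variable {N k : ℕ} [NeZero N]

/-- `t(λ) = ∑_{i=1}^{N-1} i λ_i`. -/
def grade (l : Weight N k) : ℕ := ∑ i : ZMod N, i.val * l.1 i

/-- The action `τ` of the invertible object `V_{[k]}`. The Young diagram with row lengths
`λ_j + λ_{j+1} + ... + λ_{N-1}` (`1 ≤ j ≤ N - 1`) gets a new top row of length `k`, and the
`λ_{N-1}` columns that now have `N` boxes are deleted. So the new labels are
`k - (λ_1 + ... + λ_{N-1}) = λ_0, λ_1, ..., λ_{N-2}`, and the new zeroth label is `λ_{N-1}`: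
the labels are rotated by one step. -/
def tau (l : Weight N k) : Weight N k :=
  ⟨fun i => l.1 (i - 1), (Equiv.sum_comp (Equiv.subRight (1 : ZMod N)) l.1).trans l.2⟩

/-- Duality `V_{λ*} = (V_λ)*`: `(λ*)_i = λ_{N-i}` for `1 ≤ i ≤ N - 1`, and `(λ*)_0 = λ_0`. -/
def dual (l : Weight N k) : Weight N k :=
  ⟨fun i => l.1 (-i), (Equiv.sum_comp (Equiv.neg (ZMod N)) l.1).trans l.2⟩

end

/-- `k̂ = k + N` if `N k` is odd and `k̂ = k` otherwise. -/
def kHat (N k : ℕ) : ℕ := if Odd (N * k) then k + N else k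

/-- The labels `d` of the simple current module categories: the divisors of `N / 2` if `N` is even
and `k` is odd, and the divisors of `N` otherwise. -/
def Admissible (N k d : ℕ) : Prop :=
  if Even N ∧ Odd k then d ∣ N / 2 else d ∣ N

/-- The modular invariant `Z(d,+)`:
`Z(d,+)_{λ,ν} = ∑_{i=1}^{d} δ^d(t(λ) + N i k̂ / (2d)) δ_{ν, τ^{i N/d}(λ)}`, where `δ^d(L)` is `1` if
`d ∣ L` and `0` otherwise. The two divisions are exact for admissible `d`. -/
def Zplus (N k : ℕ) [NeZero N] (d : ℕ) : Matrix (Weight N k) (Weight N k) ℕ :=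
  Matrix.of fun l n => ∑ i ∈ Finset.Icc 1 d,
    (if d ∣ grade l + N * i * kHat N k / (2 * d) then 1 else 0) *
      (if n = tau^[i * (N / d)] l then 1 else 0)

/-- The charge conjugation modular invariant `Z(1,-)_{λ,ν} = δ_{λ,ν*}`. -/
def Zminus (N k : ℕ) [NeZero N] : Matrix (Weight N k) (Weight N k) ℕ :=
  Matrix.of fun l n => if l = dual n then 1 else 0

/-- `m_d = gcd(d, N k / d)` for odd `N` and `m_d = gcd(d, N k / (2d))` for even `N`
(exact divisions for admissible `d`). -/
def mOf (N k d : ℕ) : ℕ :=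
  if Odd N then Nat.gcd d (N * k / d) else Nat.gcd d (N * k / (2 * d))

/-- The sign vector `a(d)`, indexed by the primes dividing `N`: `a(d)_p = +1` if `p` has the same
exponent in `d` and in `m_d`, and `a(d)_p = -1` otherwise. -/
def signs (N k d : ℕ) : N.primeFactors → ℤˣ := fun p =>
  if d.factorization p = (mOf N k d).factorization p then 1 else -1

/-- The equivalence relation `∼_m` on sign vectors: `a ∼_m b` iff `a_p = b_p` for those primes
`p ∣ N` at which two different exponents of `p` in `d` are compatible with `m_d = m`. With `ν, κ, μ`
the exponents of `p` in `N, k, m`, the exponents that can occur are `μ` and `ν + κ - μ - e`, where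
`e = 0` for odd `p` and `e = 1` for `p = 2`, and the second one is at most `ν` and different from
the first one iff `κ ≤ μ + e` and `2 μ + e < ν + κ`. -/
def SignEquiv (N k m : ℕ) (a b : N.primeFactors → ℤˣ) : Prop :=
  ∀ p : N.primeFactors,
    k.factorization p ≤ m.factorization p + (if (p : ℕ) = 2 then 1 else 0) →
    2 * m.factorization p + (if (p : ℕ) = 2 then 1 else 0) <
      N.factorization p + k.factorization p →
    a p = b p

/-- `d` is a label with `m_d = lcm(m_{d'}, m_{d''})` and `a(d) = a(d') a(d'')`, the latter as
classes for `∼_{m_d}`. -/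
def IsProductLabel (N k d' d'' d : ℕ) : Prop :=
  Admissible N k d ∧
  mOf N k d = Nat.lcm (mOf N k d') (mOf N k d'') ∧
  SignEquiv N k (mOf N k d) (signs N k d) (signs N k d' * signs N k d'')

end SLModInv

namespace SLModInv

/-! ### Divisibility prime by prime -/

/-! In every parity case there are `n`, `h`, `r` with `N = r * n` such that the admissible labels
are the divisors of `n`, `τ ^ r` raises the grade `t` by `2h` modulo `n`, and `Z(d,+)` is the sum
over `s` in `ℤ/n` of the shifts `τ ^ (r s)`, subject to `n/d ∣ s` and `d ∣ t + s h` (`IsShiftData`,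
`zplus_apply`).

In `Z(a,+) Z(b,+)` the total shift `s` is therefore weighted by the number of `u` in `ℤ/n` with `n/a
∣ u`, `a ∣ t + u h`, `n/b ∣ s - u` and `b ∣ t + s h + u h`. Working prime by prime and gluing with
the Chinese remainder theorem, such `u` exist exactly when `s` is allowed for the label `c =
gcd(lcm(a, b), n h / gcd(a, b))` (`exists_dvd_iff`). They then form a coset of the multiples of `n /
gcd(m_a, m_b)`, which gives the factor `gcd(m_a, m_b)` (`card_filter_allowed`). Since `c` is
symmetric in `a` and `b`, the invariants commute.

To identify `c`, let `ν`, `κ` be the exponents of `p` in `n`, `h`. If `d` has exponent `x`, then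
`m_d` has exponent `min x (ν + κ - x)`, and the sign records the side of the reflection `x ↦ ν + κ -
x` on which `x` lies. Up to `∼`, `c` is the label whose folded exponents are the maxima and whose
signs are the products (`label_exponent_iff`).

Duality negates both grade and shift, which preserves the conditions on them. -/

theorem natCast_dvd_iff_forall_prime_pow {m : ℕ} (hm : m ≠ 0) (z : ℤ) :
    (m : ℤ) ∣ z ↔ ∀ p : ℕ, p.Prime → (p : ℤ) ^ m.factorization p ∣ z := by
  refine ⟨fun h p _ => dvd_trans (by exact_mod_cast Nat.ordProj_dvd m p) h, fun h => ?_⟩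
  rw [Int.natCast_dvd, Nat.dvd_iff_prime_pow_dvd_dvd]
  intro p j hp hj
  have := h p hp
  rw [← Nat.cast_pow, Int.natCast_dvd] at this
  exact (pow_dvd_pow p ((hp.pow_dvd_iff_le_factorization hm).1 hj)).trans this

theorem exists_forall_prime_pow_dvd_sub (n : ℕ) (u : ℕ → ℤ) :
    ∃ x : ℤ, ∀ p : ℕ, p.Prime → (p : ℤ) ^ n.factorization p ∣ x - u p := by
  have hs : ∀ p ∈ n.primeFactors, p ^ n.factorization p ≠ 0 := fun p hp =>
    pow_ne_zero _ (Nat.prime_of_mem_primeFactors hp).ne_zero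
  have pp : Set.Pairwise (n.primeFactors : Set ℕ)
      (Function.onFun Nat.Coprime fun p => p ^ n.factorization p) := fun p hp q hq hpq =>
    Nat.coprime_pow_primes _ _ (Nat.prime_of_mem_primeFactors hp)
      (Nat.prime_of_mem_primeFactors hq) hpq
  obtain ⟨x, hx⟩ := Nat.chineseRemainderOfFinset
    (fun p => (u p % ((p ^ n.factorization p : ℕ) : ℤ)).toNat)
    (fun p => p ^ n.factorization p) n.primeFactors hs pp
  refine ⟨x, fun p hp => ?_⟩
  by_cases hpn : p ∈ n.primeFactors
  · have h1 := (Int.natCast_modEq_iff.2 (hx p hpn))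
    rw [Int.toNat_of_nonneg (Int.emod_nonneg _ (by exact_mod_cast hs p hpn))] at h1
    have h2 := (h1.trans (Int.mod_modEq _ _)).symm.dvd
    exact_mod_cast h2
  · have : n.factorization p = 0 := Finsupp.notMem_support_iff.1 hpn
    simp [this]

theorem pow_factorization_mul_eq {h : ℕ} (hh : h ≠ 0) {p : ℕ} (hp : p.Prime) :
    ∃ y : ℤ, (h : ℤ) = (p : ℤ) ^ h.factorization p * y ∧ ∀ j : ℕ, IsCoprime y ((p : ℤ) ^ j) := by
  refine ⟨((h / p ^ h.factorization p : ℕ) : ℤ), ?_, fun j => ?_⟩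
  · exact_mod_cast (Nat.ordProj_mul_ordCompl_eq_self h p).symm
  · have : Nat.Coprime (h / p ^ h.factorization p) (p ^ j) :=
      ((Nat.coprime_ordCompl hp hh).symm).pow_right j
    exact_mod_cast Nat.isCoprime_iff_coprime.2 this

theorem pow_dvd_mul_natCast_iff {h : ℕ} (hh : h ≠ 0) {p : ℕ} (hp : p.Prime) (a : ℕ) (w : ℤ) :
    (p : ℤ) ^ a ∣ w * h ↔ (p : ℤ) ^ (a - h.factorization p) ∣ w := by
  obtain ⟨y, hy, hc⟩ := pow_factorization_mul_eq hh hp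
  have hp0 : (p : ℤ) ≠ 0 := by exact_mod_cast hp.ne_zero
  rw [hy]
  rcases le_total a (h.factorization p) with hle | hle
  · rw [Nat.sub_eq_zero_of_le hle]
    simpa using ((pow_dvd_pow (p : ℤ) hle).mul_right y).mul_left w
  · obtain ⟨e, rfl⟩ := Nat.exists_eq_add_of_le hle
    rw [Nat.add_sub_cancel_left, pow_add, mul_left_comm,
      mul_dvd_mul_iff_left (pow_ne_zero _ hp0)]
    exact ⟨(hc e).symm.dvd_of_dvd_mul_right, fun h => h.mul_right y⟩

/-- The part of `h` prime to `p` is invertible modulo `p ^ N`, so `z + u h ≡ 0` can be solved once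
`p ^ κ` is divided out; the surplus factor `p ^ e` of `z` passes to `u`. -/
theorem exists_pow_dvd_add_mul {h : ℕ} (hh : h ≠ 0) {p : ℕ} (hp : p.Prime) (e N : ℕ) {z : ℤ}
    (hz : (p : ℤ) ^ (e + h.factorization p) ∣ z) :
    ∃ u : ℤ, (p : ℤ) ^ e ∣ u ∧ (p : ℤ) ^ N ∣ z + u * h := by
  obtain ⟨y, hy, hc⟩ := pow_factorization_mul_eq hh hp
  obtain ⟨w, rfl⟩ := hz
  obtain ⟨s, r, hsr⟩ := hc N
  refine ⟨(p : ℤ) ^ e * (-(s * w)), dvd_mul_right _ _, ?_⟩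
  rw [hy]
  refine ⟨p ^ (e + h.factorization p) * r * w, ?_⟩
  have : w = w * (s * y + r * p ^ N) := by rw [hsr, mul_one]
  rw [pow_add]
  linear_combination ((p : ℤ) ^ e * p ^ h.factorization p) * this

/-- The local form of the product rule, with `a`, `b`, `c` exponents of `p`. The minimum defining
`c` is `max a b` when `a + b ≤ ν + κ`, and `ν + κ - min a b` otherwise. -/
theorem exists_prime_pow_dvd_iff {h : ℕ} (hh : h ≠ 0) {p : ℕ} (hp : p.Prime) {ν a b c : ℕ}
    (ha : a ≤ ν) (hb : b ≤ ν)
    (hc : c = min (max a b) (ν + h.factorization p - min a b)) (t s : ℤ) :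
    (∃ u : ℤ, (p : ℤ) ^ (ν - a) ∣ u ∧ (p : ℤ) ^ a ∣ t + u * h ∧ (p : ℤ) ^ (ν - b) ∣ s - u ∧
      (p : ℤ) ^ b ∣ t + s * h + u * h) ↔
    (p : ℤ) ^ (ν - c) ∣ s ∧ (p : ℤ) ^ c ∣ t + s * h := by
  have mono : ∀ {i j : ℕ} {z : ℤ}, i ≤ j → (p : ℤ) ^ j ∣ z → (p : ℤ) ^ i ∣ z :=
    fun hij hz => (pow_dvd_pow _ hij).trans hz
  have mulh : ∀ {i j : ℕ} {z : ℤ}, (p : ℤ) ^ j ∣ z → i ≤ j + h.factorization p →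
      (p : ℤ) ^ i ∣ z * h := fun hz hij =>
    (pow_dvd_mul_natCast_iff hh hp _ _).2 (mono (by omega) hz)
  have divh : ∀ {i j : ℕ} {z : ℤ}, (p : ℤ) ^ j ∣ z * h → i + h.factorization p ≤ j →
      (p : ℤ) ^ i ∣ z := fun hz hij =>
    mono (by omega) ((pow_dvd_mul_natCast_iff hh hp _ _).1 hz)
  set κ := h.factorization p
  constructor
  · rintro ⟨u, h1, h2, h3, h4⟩
    rcases le_or_gt (a + b) (ν + κ) with hle | hgt
    · constructor
      · have := dvd_add (mono (i := ν - c) (by omega) h1) (mono (i := ν - c) (by omega) h3)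
        simpa using this
      · rcases le_total a b with hab | hab
        · have := dvd_sub (mono (i := c) (by omega) h4) (mulh (i := c) h1 (by omega))
          simpa using this
        · have := dvd_add (mono (i := c) (by omega) h2) (mulh (i := c) h3 (by omega))
          exact this.trans (dvd_of_eq (by ring))
    · constructor
      -- The difference of the two grade conditions is `s h`, and here `ν - c = min a b - κ`.
      · refine divh (j := min a b) ?_ (by omega)
        have := dvd_sub (mono (i := min a b) (by omega) h4) (mono (i := min a b) (by omega) h2)
        exact this.trans (dvd_of_eq (by ring))
      · rcases le_total a b with hab | hab
        · have := dvd_sub (mono (i := c) (by omega) h4) (mulh (i := c) h1 (by omega))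
          simpa using this
        · have := dvd_add (mono (i := c) (by omega) h2) (mulh (i := c) h3 (by omega))
          exact this.trans (dvd_of_eq (by ring))
  · rintro ⟨h1, h2⟩
    rcases le_or_gt (a + b) (ν + κ) with hle | hgt
    -- The label with the larger exponent can carry the whole shift: `u = 0` or `u = s`.
    · rcases le_total a b with hab | hab
      · refine ⟨0, dvd_zero _, ?_, ?_, ?_⟩
        · have := dvd_sub (mono (i := a) (by omega) h2) (mulh (i := a) h1 (by omega))
          simpa using this
        · simpa using mono (by omega) h1
        · simpa using mono (by omega) h2
      · refine ⟨s, mono (by omega) h1, mono (by omega) h2, by simp, ?_⟩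
        exact dvd_add (mono (by omega) h2) (mulh h1 (by omega))
    · have hs : (p : ℤ) ^ (min a b) ∣ s * h := mulh h1 (by omega)
      rcases le_total a b with hab | hab
      -- Here `c = ν - a + κ`, just enough divisibility to solve `t + s h + u h ≡ 0` modulo `p ^ ν`
      -- with `p ^ (ν - a) ∣ u`.
      · obtain ⟨u, hu, hu'⟩ := exists_pow_dvd_add_mul hh hp (ν - a) ν
          (mono (show ν - a + κ ≤ c by omega) h2)
        refine ⟨u, hu, ?_, ?_, mono hb hu'⟩
        · have := dvd_sub (mono (i := a) (by omega) hu') (mono (i := a) (by omega) hs)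
          exact this.trans (dvd_of_eq (by ring))
        · exact dvd_sub (mono (by omega) h1) (mono (by omega) hu)
      · obtain ⟨v, hv, hv'⟩ := exists_pow_dvd_add_mul hh hp (ν - b) ν
          (mono (show ν - b + κ ≤ c by omega) h2)
        refine ⟨s + v, ?_, ?_, ?_, ?_⟩
        · exact dvd_add (mono (by omega) h1) (mono (by omega) hv)
        · exact (mono ha hv').trans (dvd_of_eq (by ring))
        · simpa using mono (by omega) hv
        · have := dvd_add (mono (i := b) (by omega) hv') (mono (i := b) (by omega) hs)
          exact this.trans (dvd_of_eq (by ring))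

/-! ### The label of a product -/

/-- The label of the product of the invariants labelled `a` and `b`, where `n` is the modulus for
the labels and `2 h` is the change of the grading under the elementary shift. -/
def prodLabel (n h a b : ℕ) : ℕ := Nat.gcd (Nat.lcm a b) (n * h / Nat.gcd a b)

section
variable {n h a b : ℕ}

theorem prodLabel_dvd (ha : a ∣ n) (hb : b ∣ n) : prodLabel n h a b ∣ n :=
  (Nat.gcd_dvd_left _ _).trans (Nat.lcm_dvd ha hb)

theorem prodLabel_comm : prodLabel n h a b = prodLabel n h b a := by
  rw [prodLabel, prodLabel, Nat.lcm_comm, Nat.gcd_comm a b]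

theorem div_ne_zero_of_dvd (hn : n ≠ 0) (ha : a ∣ n) : n / a ≠ 0 := by
  obtain ⟨c, rfl⟩ := ha
  have : a ≠ 0 := by rintro rfl; simp at hn
  rw [Nat.mul_div_cancel_left _ (Nat.pos_of_ne_zero this)]
  rintro rfl; simp at hn

theorem factorization_prodLabel (hn : n ≠ 0) (hh : h ≠ 0) (ha : a ∣ n) (hb : b ∣ n) (p : ℕ) :
    (prodLabel n h a b).factorization p =
      min (max (a.factorization p) (b.factorization p))
        (n.factorization p + h.factorization p -
          min (a.factorization p) (b.factorization p)) := by
  have ha0 := ne_zero_of_dvd_ne_zero hn ha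
  have hb0 := ne_zero_of_dvd_ne_zero hn hb
  have hg : Nat.gcd a b ∣ n * h := ((Nat.gcd_dvd_left a b).trans ha).mul_right h
  rw [prodLabel, Nat.factorization_gcd (Nat.lcm_ne_zero ha0 hb0)
    (div_ne_zero_of_dvd (mul_ne_zero hn hh) hg), Nat.factorization_lcm ha0 hb0,
    Nat.factorization_div hg, Nat.factorization_gcd ha0 hb0, Nat.factorization_mul hn hh]
  rfl

theorem factorization_gcd_div (hn : n ≠ 0) (hh : h ≠ 0) (ha : a ∣ n) (p : ℕ) :
    (Nat.gcd a (n * h / a)).factorization p =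
      min (a.factorization p) (n.factorization p + h.factorization p - a.factorization p) := by
  have ha0 := ne_zero_of_dvd_ne_zero hn ha
  rw [Nat.factorization_gcd ha0 (div_ne_zero_of_dvd (mul_ne_zero hn hh) (ha.mul_right h)),
    Nat.factorization_div (ha.mul_right h), Nat.factorization_mul hn hh]
  rfl

theorem factorization_le_of_dvd (hn : n ≠ 0) (ha : a ∣ n) (p : ℕ) :
    a.factorization p ≤ n.factorization p :=
  (Nat.factorization_le_iff_dvd (ne_zero_of_dvd_ne_zero hn ha) hn).2 ha p

theorem exists_dvd_iff (hn : n ≠ 0) (hh : h ≠ 0) (ha : a ∣ n) (hb : b ∣ n) (t s : ℤ) :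
    (∃ u : ℤ, ((n / a : ℕ) : ℤ) ∣ u ∧ (a : ℤ) ∣ t + u * h ∧ ((n / b : ℕ) : ℤ) ∣ s - u ∧
      (b : ℤ) ∣ t + s * h + u * h) ↔
    ((n / prodLabel n h a b : ℕ) : ℤ) ∣ s ∧ (prodLabel n h a b : ℤ) ∣ t + s * h := by
  have ha0 := ne_zero_of_dvd_ne_zero hn ha
  have hb0 := ne_zero_of_dvd_ne_zero hn hb
  have hc := prodLabel_dvd (h := h) ha hb
  have hc0 := ne_zero_of_dvd_ne_zero hn hc
  have hna := div_ne_zero_of_dvd hn ha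
  have hnb := div_ne_zero_of_dvd hn hb
  have hnc := div_ne_zero_of_dvd hn hc
  have loc : ∀ p : ℕ, p.Prime → _ := fun p hp =>
    exists_prime_pow_dvd_iff hh hp (factorization_le_of_dvd hn ha p)
      (factorization_le_of_dvd hn hb p) (factorization_prodLabel hn hh ha hb p) t s
  simp only [natCast_dvd_iff_forall_prime_pow ha0, natCast_dvd_iff_forall_prime_pow hb0,
    natCast_dvd_iff_forall_prime_pow hc0, natCast_dvd_iff_forall_prime_pow hna,
    natCast_dvd_iff_forall_prime_pow hnb, natCast_dvd_iff_forall_prime_pow hnc,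
    Nat.factorization_div ha, Nat.factorization_div hb, Nat.factorization_div hc,
    Finsupp.tsub_apply]
  constructor
  · rintro ⟨u, h1, h2, h3, h4⟩
    have := fun p hp => (loc p hp).1 ⟨u, h1 p hp, h2 p hp, h3 p hp, h4 p hp⟩
    exact ⟨fun p hp => (this p hp).1, fun p hp => (this p hp).2⟩
  · rintro ⟨h1, h2⟩
    have := fun (p : ℕ) (hp : p.Prime) => (loc p hp).2 ⟨h1 p hp, h2 p hp⟩
    choose! u hu using this
    obtain ⟨x, hx⟩ := exists_forall_prime_pow_dvd_sub n u
    -- All moduli divide `n`, so the conditions at `p` depend only on `u` modulo the `p`-part of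
    -- `n`.
    have key : ∀ p : ℕ, p.Prime → ∀ j ≤ n.factorization p, ∀ z w : ℤ, x - u p ∣ z - w →
        (p : ℤ) ^ j ∣ w → (p : ℤ) ^ j ∣ z := fun p hp j hj z w hzw hw => by
      have := dvd_add (((pow_dvd_pow _ hj).trans (hx p hp)).trans hzw) hw
      simpa using this
    refine ⟨x, fun p hp => ?_, fun p hp => ?_, fun p hp => ?_, fun p hp => ?_⟩
    · exact key p hp _ (Nat.sub_le _ _) _ _ dvd_rfl (hu p hp).1
    · exact key p hp _ (factorization_le_of_dvd hn ha p) _ _ ⟨h, by ring⟩ (hu p hp).2.1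
    · exact key p hp _ (Nat.sub_le _ _) _ _ ⟨-1, by ring⟩ (hu p hp).2.2.1
    · exact key p hp _ (factorization_le_of_dvd hn hb p) _ _ ⟨h, by ring⟩ (hu p hp).2.2.2

/-- These are the homogeneous conditions on a difference of two solutions `u`. At each prime it
comes down to `max (ν - x) (x - κ) = ν - min x (ν + κ - x)` for `x ≤ ν`. -/
theorem dvd_and_dvd_mul_iff (hn : n ≠ 0) (hh : h ≠ 0) (ha : a ∣ n) (hb : b ∣ n) (w : ℤ) :
    (((n / a : ℕ) : ℤ) ∣ w ∧ (a : ℤ) ∣ w * h ∧ ((n / b : ℕ) : ℤ) ∣ w ∧ (b : ℤ) ∣ w * h) ↔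
    ((n / Nat.gcd (Nat.gcd a (n * h / a)) (Nat.gcd b (n * h / b)) : ℕ) : ℤ) ∣ w := by
  have ha0 := ne_zero_of_dvd_ne_zero hn ha
  have hb0 := ne_zero_of_dvd_ne_zero hn hb
  have hg : Nat.gcd (Nat.gcd a (n * h / a)) (Nat.gcd b (n * h / b)) ∣ n :=
    (Nat.gcd_dvd_left _ _).trans ((Nat.gcd_dvd_left _ _).trans ha)
  have hna := div_ne_zero_of_dvd hn ha
  have hnb := div_ne_zero_of_dvd hn hb
  have hng := div_ne_zero_of_dvd hn hg
  simp only [natCast_dvd_iff_forall_prime_pow ha0, natCast_dvd_iff_forall_prime_pow hb0,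
    natCast_dvd_iff_forall_prime_pow hna,
    natCast_dvd_iff_forall_prime_pow hnb, natCast_dvd_iff_forall_prime_pow hng,
    Nat.factorization_div ha, Nat.factorization_div hb, Nat.factorization_div hg,
    Finsupp.tsub_apply, ← forall_and]
  refine forall_congr' fun p => ?_
  by_cases hp : p.Prime
  swap
  · simp [hp]
  have hfa := factorization_le_of_dvd hn ha p
  have hfb := factorization_le_of_dvd hn hb p
  have hfg : (Nat.gcd (Nat.gcd a (n * h / a)) (Nat.gcd b (n * h / b))).factorization p =
      min (min (a.factorization p) (n.factorization p + h.factorization p - a.factorization p))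
        (min (b.factorization p) (n.factorization p + h.factorization p - b.factorization p)) := by
    rw [Nat.factorization_gcd (Nat.gcd_ne_zero_left ha0) (Nat.gcd_ne_zero_left hb0),
      Finsupp.inf_apply, factorization_gcd_div hn hh ha, factorization_gcd_div hn hh hb]
  simp only [hp, forall_const, pow_dvd_mul_natCast_iff hh hp, hfg]
  have mono : ∀ {i j : ℕ}, i ≤ j → (p : ℤ) ^ j ∣ w → (p : ℤ) ^ i ∣ w :=
    fun hij hz => (pow_dvd_pow _ hij).trans hz
  constructor
  · rintro ⟨h1, h2, h3, h4⟩
    have h5 : (p : ℤ) ^ (max (max (n.factorization p - a.factorization p)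
        (a.factorization p - h.factorization p)) (max (n.factorization p - b.factorization p)
        (b.factorization p - h.factorization p))) ∣ w := by
      rcases max_choice (max (n.factorization p - a.factorization p)
        (a.factorization p - h.factorization p)) (max (n.factorization p - b.factorization p)
        (b.factorization p - h.factorization p)) with e | e <;> rw [e]
      · rcases max_choice (n.factorization p - a.factorization p)
          (a.factorization p - h.factorization p) with e | e <;> rw [e] <;> assumption
      · rcases max_choice (n.factorization p - b.factorization p)
          (b.factorization p - h.factorization p) with e | e <;> rw [e] <;> assumption
    exact mono (by omega) h5
  · intro h1
    exact ⟨mono (by omega) h1, mono (by omega) h1, mono (by omega) h1, mono (by omega) h1⟩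

end

/-! ### Reduction to a uniform set of parameters -/

/-- Parameters describing the modular invariants uniformly: the labels are the divisors of `n`, the
shifts that occur are powers of `τ ^ r`, and `τ ^ r` changes the grading by `2 h` modulo `n`. -/
structure IsShiftData (N k n h r : ℕ) : Prop where
  eq_mul : N = r * n
  two_mul_modEq : 2 * h ≡ r * k [MOD n]
  mul_kHat : N * kHat N k = 2 * (n * h)
  ne_zero : n ≠ 0
  factor_ne_zero : r ≠ 0
  shift_ne_zero : h ≠ 0
  admissible_iff : ∀ d, Admissible N k d ↔ d ∣ n
  mOf_eq : ∀ d, d ∣ n → mOf N k d = Nat.gcd d (n * h / d)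
  ambiguous_iff : ∀ p : ℕ, p.Prime → p ∣ N → ∀ μ ≤ n.factorization p,
    (k.factorization p ≤ μ + (if p = 2 then 1 else 0) ∧
      2 * μ + (if p = 2 then 1 else 0) < N.factorization p + k.factorization p) ↔
    (h.factorization p ≤ μ ∧ 2 * μ < n.factorization p + h.factorization p)

theorem IsShiftData.dvd {N k n h r : ℕ} (D : IsShiftData N k n h r) : n ∣ N :=
  ⟨r, by rw [D.eq_mul, mul_comm]⟩

theorem factorization_two_mul {m : ℕ} (hm : m ≠ 0) (p : ℕ) :
    (2 * m).factorization p = (if p = 2 then 1 else 0) + m.factorization p := by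
  rw [Nat.factorization_mul two_ne_zero hm, Finsupp.add_apply, Nat.prime_two.factorization,
    Finsupp.single_apply]
  simp [eq_comm]

theorem min_factorization_eq_of_gcd_eq {n x y p : ℕ} (hn : n ≠ 0) (hx : x ≠ 0) (hy : y ≠ 0)
    (hxy : Nat.gcd x n = Nat.gcd y n) :
    min (x.factorization p) (n.factorization p) = min (y.factorization p) (n.factorization p) := by
  have := congrArg (fun m => m.factorization p) hxy
  simpa [Nat.factorization_gcd hx hn, Nat.factorization_gcd hy hn] using this

theorem gcd_two_mul_div {n h d : ℕ} (hn : Odd n) (hd : d ∣ n) :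
    Nat.gcd d (n * (2 * h) / d) = Nat.gcd d (n * h / d) := by
  have hd2 : Nat.Coprime d 2 := (Nat.coprime_two_right.2 (hn.of_dvd_nat hd))
  rw [mul_left_comm, Nat.mul_div_assoc _ (hd.mul_right h), hd2.symm.gcd_mul_left_cancel_right]

theorem isShiftData_of_odd {N k : ℕ} (hk : 1 ≤ k) (hN : Odd N) :
    IsShiftData N k N (kHat N k / 2) 1 := by
  have hN0 : N ≠ 0 := by rintro rfl; simp at hN
  have hev : 2 * (kHat N k / 2) = kHat N k := by
    refine Nat.two_mul_div_two_of_even ?_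
    unfold kHat
    split_ifs with h
    · exact (Nat.odd_mul.1 h).2.add_odd hN
    · exact Nat.not_odd_iff_even.1 fun hk' => h (hN.mul hk')
  have hkhat : kHat N k = k ∨ kHat N k = k + N := by unfold kHat; split_ifs <;> simp
  have hk0 : kHat N k ≠ 0 := by omega
  generalize kHat N k / 2 = h at *
  have hh : h ≠ 0 := by omega
  refine ⟨(one_mul N).symm, ?_, ?_, hN0, one_ne_zero, hh, fun d => ?_, fun d hd => ?_, ?_⟩
  · rw [hev, one_mul]
    rcases hkhat with e | e <;> rw [e]
    simp [Nat.ModEq]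
  · rw [← hev]; ring
  · simp [Admissible, Nat.not_even_iff_odd.2 hN]
  -- As `d` is odd, doubling `h` does not change the gcd; replacing `k` by `k + N` adds a multiple
  -- of `d` to `N k / d`.
  · rw [mOf, if_pos hN, ← gcd_two_mul_div (h := h) hN hd, hev]
    rcases hkhat with e | e <;> rw [e]
    obtain ⟨c, rfl⟩ := hd
    have hd0 : 0 < d := Nat.pos_of_ne_zero (by rintro rfl; simp at hN0)
    rw [mul_assoc, mul_assoc, Nat.mul_div_cancel_left _ hd0, Nat.mul_div_cancel_left _ hd0,
      mul_add, mul_left_comm, Nat.gcd_add_mul_left_right]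
  · intro p hp hpN μ hμ
    have hp2 : p ≠ 2 := by
      rintro rfl
      exact Nat.not_even_iff_odd.2 hN (even_iff_two_dvd.2 hpN)
    -- `k` and `k + N` have the same exponent only up to truncation at that of `N`. This suffices:
    -- for `μ ≤ ν ≤ κ` the two inequalities are never both true.
    have h2 := min_factorization_eq_of_gcd_eq (p := p) hN0 (x := 2 * h) (y := k) (by omega)
      (by omega) (by rw [hev]; rcases hkhat with e | e <;> rw [e]; simp)
    rw [factorization_two_mul hh] at h2
    simp only [hp2, if_false] at h2 ⊢
    omega

theorem isShiftData_of_even_of_even {N k : ℕ} (hN0 : N ≠ 0) (hk : 1 ≤ k) (hN : Even N)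
    (hke : Even k) : IsShiftData N k N (k / 2) 1 := by
  obtain ⟨h, rfl⟩ := even_iff_two_dvd.1 hke
  have hh : h ≠ 0 := by omega
  rw [Nat.mul_div_cancel_left _ two_pos]
  refine ⟨(one_mul N).symm, by simp [Nat.ModEq], ?_, hN0, one_ne_zero, hh, fun d => ?_, fun d hd => ?_, ?_⟩
  · rw [kHat, if_neg (by simp [Nat.odd_mul])]; ring
  · simp [Admissible]
  · rw [mOf, if_neg (Nat.not_odd_iff_even.2 hN), mul_left_comm, Nat.mul_div_mul_left _ _ two_pos]
  · intro p hp hpN μ hμ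
    rw [factorization_two_mul hh]
    split_ifs <;> omega

theorem isShiftData_of_even_of_odd {N k : ℕ} (hN0 : N ≠ 0) (hN : Even N) (hko : Odd k) :
    IsShiftData N k (N / 2) k 2 := by
  obtain ⟨n, rfl⟩ := even_iff_two_dvd.1 hN
  have hn : n ≠ 0 := by rintro rfl; simp at hN0
  have hk : k ≠ 0 := by rintro rfl; simp at hko
  rw [Nat.mul_div_cancel_left _ two_pos]
  refine ⟨rfl, rfl, ?_, hn, two_ne_zero, hk, fun d => ?_, fun d hd => ?_, ?_⟩
  · rw [kHat, if_neg (by simp [Nat.odd_mul])]; ring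
  · simp [Admissible, hko]
  · rw [mOf, if_neg (by simp), mul_assoc, Nat.mul_div_mul_left _ _ two_pos]
  · intro p hp hpN μ hμ
    rw [factorization_two_mul hn]
    split_ifs with h2
    · subst h2
      -- The extra factor `2` in `N = 2 n` offsets `e_2 = 1`, and the first inequality is trivial
      -- because `k` is odd.
      rw [Nat.factorization_eq_zero_of_not_dvd (n := k) (p := 2)
        (fun h => Nat.not_even_iff_odd.2 hko (even_iff_two_dvd.2 h))]
      omega
    · omega

theorem exists_isShiftData {N k : ℕ} (hN : N ≠ 0) (hk : 1 ≤ k) :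
    ∃ n h r, IsShiftData N k n h r := by
  rcases Nat.even_or_odd N with hNe | hNo
  · rcases Nat.even_or_odd k with hke | hko
    · exact ⟨_, _, _, isShiftData_of_even_of_even hN hk hNe hke⟩
    · exact ⟨_, _, _, isShiftData_of_even_of_odd hN hNe hko⟩
  · exact ⟨_, _, _, isShiftData_of_odd hk hNo⟩

theorem sign_eq_mul_iff (A B C : Prop) [Decidable A] [Decidable B] [Decidable C] :
    ((if A then 1 else -1 : ℤˣ) = (if B then 1 else -1) * (if C then 1 else -1)) ↔
      (A ↔ (B ↔ C)) := by
  split_ifs <;> simp [*]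

/-- A sign is `+1` exactly when `2 x ≤ ν + κ`. The folded exponent leaves two candidates for `d`,
and the sign is consulted only when they are distinct and both at most `ν`. -/
theorem label_exponent_iff {ν κ a b d : ℕ} (ha : a ≤ ν) (hb : b ≤ ν) (hd : d ≤ ν) :
    (min d (ν + κ - d) = max (min a (ν + κ - a)) (min b (ν + κ - b)) ∧
      (κ ≤ min d (ν + κ - d) ∧ 2 * min d (ν + κ - d) < ν + κ →
        (d = min d (ν + κ - d) ↔ (a = min a (ν + κ - a) ↔ b = min b (ν + κ - b))))) ↔
    d = min (max a b) (ν + κ - min a b) := by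
  have key : ∀ x : ℕ, (x = min x (ν + κ - x) ↔ 2 * x ≤ ν + κ) := fun x => by omega
  have left : ∀ {x : ℕ}, 2 * x ≤ ν + κ → min x (ν + κ - x) = x := fun hx => by omega
  have right : ∀ {x : ℕ}, ν + κ < 2 * x → min x (ν + κ - x) = ν + κ - x := fun hx => by omega
  rw [key, key, key]
  rcases le_or_gt (2 * a) (ν + κ) with h1 | h1 <;> rcases le_or_gt (2 * b) (ν + κ) with h2 | h2 <;>
  rcases le_or_gt (2 * d) (ν + κ) with h3 | h3 <;>
  simp only [h1, h2, h3, left, right, not_le.2, iff_true, iff_false, not_true,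
    imp_false, implies_true, and_true] <;> omega

theorem IsShiftData.isProductLabel_iff {N k n h r : ℕ} (D : IsShiftData N k n h r) {a b d : ℕ}
    (ha : a ∣ n) (hb : b ∣ n) : IsProductLabel N k a b d ↔ d = prodLabel n h a b := by
  have hn := D.ne_zero
  have hh := D.shift_ne_zero
  have hN0 : N ≠ 0 := D.eq_mul ▸ mul_ne_zero D.factor_ne_zero hn
  have key : ∀ {d}, d ∣ n → (IsProductLabel N k a b d ↔ d = prodLabel n h a b) := by
    intro d hd
    have hp : prodLabel n h a b ∣ n := prodLabel_dvd ha hb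
    have hm0 : ∀ {c}, c ∣ n → Nat.gcd c (n * h / c) ≠ 0 := fun hc =>
      Nat.gcd_ne_zero_left (ne_zero_of_dvd_ne_zero hn hc)
    have e1 : d = prodLabel n h a b ↔ ∀ p : ℕ, p.Prime → d.factorization p =
        min (max (a.factorization p) (b.factorization p))
        (n.factorization p + h.factorization p -
          min (a.factorization p) (b.factorization p)) := by
      simp only [← factorization_prodLabel hn hh ha hb]
      refine ⟨fun e p _ => by rw [← e], fun e => ?_⟩
      refine Nat.eq_of_factorization_eq (ne_zero_of_dvd_ne_zero hn hd)
        (ne_zero_of_dvd_ne_zero hn hp) fun p => ?_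
      by_cases hp : p.Prime
      · exact e p hp
      · simp [hp]
    have e2 : (mOf N k d = Nat.lcm (mOf N k a) (mOf N k b)) ↔ ∀ p : ℕ, p.Prime →
        (mOf N k d).factorization p =
          max ((mOf N k a).factorization p) ((mOf N k b).factorization p) := by
      rw [D.mOf_eq d hd, D.mOf_eq a ha, D.mOf_eq b hb]
      have hl := Nat.lcm_ne_zero (hm0 ha) (hm0 hb)
      have hf := Nat.factorization_lcm (hm0 ha) (hm0 hb)
      refine ⟨fun e p _ => by rw [e, hf]; rfl, fun e => ?_⟩
      refine Nat.eq_of_factorization_eq (hm0 hd) hl fun p => ?_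
      by_cases hp : p.Prime
      · rw [e p hp, hf]; rfl
      · simp [hp]
    have fm : ∀ {c}, c ∣ n → ∀ p, (mOf N k c).factorization p =
        min (c.factorization p) (n.factorization p + h.factorization p - c.factorization p) :=
      fun hc p => by rw [D.mOf_eq _ hc, factorization_gcd_div hn hh hc]
    have e3 : SignEquiv N k (mOf N k d) (signs N k d) (signs N k a * signs N k b) ↔
        ∀ p : ℕ, p.Prime → p ∣ N →
          (h.factorization p ≤ (mOf N k d).factorization p ∧
            2 * (mOf N k d).factorization p < n.factorization p + h.factorization p →
          (d.factorization p = (mOf N k d).factorization p ↔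
            (a.factorization p = (mOf N k a).factorization p ↔
              b.factorization p = (mOf N k b).factorization p))) := by
      simp only [SignEquiv, signs, Pi.mul_apply, sign_eq_mul_iff]
      constructor
      · intro H p hp hpN hc
        refine and_imp.2 (H ⟨p, Nat.mem_primeFactors.2 ⟨hp, hpN, hN0⟩⟩)
          ((D.ambiguous_iff p hp hpN _ ?_).2 hc)
        rw [fm hd]
        exact (min_le_left _ _).trans (factorization_le_of_dvd hn hd p)
      · rintro H ⟨p, hpm⟩ hc₁ hc₂
        have hp := Nat.prime_of_mem_primeFactors hpm
        have hpN := Nat.dvd_of_mem_primeFactors hpm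
        refine H p hp hpN ((D.ambiguous_iff p hp hpN _ ?_).1 ⟨hc₁, hc₂⟩)
        rw [fm hd]
        exact (min_le_left _ _).trans (factorization_le_of_dvd hn hd p)
    rw [IsProductLabel, D.admissible_iff, e1, e2, e3]
    simp only [hd, true_and, ← forall_and]
    refine forall_congr' fun p => ?_
    refine forall_congr' fun hp => ?_
    simp only [fm hd, fm ha, fm hb]
    have hda := factorization_le_of_dvd hn hd p
    have haa := factorization_le_of_dvd hn ha p
    have hba := factorization_le_of_dvd hn hb p
    by_cases hpN : p ∣ N
    · simpa only [hpN, forall_const] using label_exponent_iff haa hba hda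
    -- No sign is attached to such a prime, but all exponents of labels vanish there.
    · have h0 : n.factorization p = 0 :=
        Nat.factorization_eq_zero_of_not_dvd fun h => hpN (h.trans D.dvd)
      simp only [hpN, false_imp_iff, and_true]
      omega
  refine ⟨fun H => (key ((D.admissible_iff d).1 H.1)).1 H, fun H => ?_⟩
  exact (key (H ▸ prodLabel_dvd ha hb)).2 H

/-! ### Divisibility in `ZMod n` -/

section
variable {n h a b d : ℕ}

theorem natCast_dvd_intCast_zmod_iff (hd : d ∣ n) (z : ℤ) :
    (d : ZMod n) ∣ (z : ZMod n) ↔ (d : ℤ) ∣ z := by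
  constructor
  · rintro ⟨y, hy⟩
    obtain ⟨y, rfl⟩ := ZMod.intCast_surjective y
    have h0 : ((z - d * y : ℤ) : ZMod n) = 0 := by push_cast; rw [hy, sub_self]
    have h1 := (Int.natCast_dvd_natCast.2 hd).trans ((ZMod.intCast_zmod_eq_zero_iff_dvd _ n).1 h0)
    exact (dvd_sub_left (dvd_mul_right _ _)).1 h1
  · intro hz
    simpa using map_dvd (Int.castRingHom (ZMod n)) hz

/-- The condition on the grade `t` and the shift `s` for a nonzero term in the invariant labelled
`d`. -/
def Allowed (n h d : ℕ) (t s : ZMod n) : Prop :=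
  ((n / d : ℕ) : ZMod n) ∣ s ∧ (d : ZMod n) ∣ t + s * h

theorem allowed_neg_neg (t s : ZMod n) : Allowed n h d (-t) (-s) ↔ Allowed n h d t s := by
  rw [Allowed, Allowed, dvd_neg, show -t + -s * h = -(t + s * h) by ring, dvd_neg]

theorem exists_allowed_iff (hn : n ≠ 0) (hh : h ≠ 0) (ha : a ∣ n) (hb : b ∣ n) (t s : ZMod n) :
    (∃ u, Allowed n h a t u ∧ Allowed n h b (t + u * (2 * h)) (s - u)) ↔
      Allowed n h (prodLabel n h a b) t s := by
  obtain ⟨t, rfl⟩ := ZMod.intCast_surjective t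
  obtain ⟨s, rfl⟩ := ZMod.intCast_surjective s
  have hc := prodLabel_dvd (h := h) ha hb
  have := exists_dvd_iff hn hh ha hb t s
  simp only [← natCast_dvd_intCast_zmod_iff ha, ← natCast_dvd_intCast_zmod_iff hb,
    ← natCast_dvd_intCast_zmod_iff hc, ← natCast_dvd_intCast_zmod_iff (Nat.div_dvd_of_dvd ha),
    ← natCast_dvd_intCast_zmod_iff (Nat.div_dvd_of_dvd hb),
    ← natCast_dvd_intCast_zmod_iff (Nat.div_dvd_of_dvd hc)] at this
  push_cast at this
  rw [Allowed, ← this, (ZMod.intCast_surjective (n := n)).exists]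
  refine exists_congr fun u => ?_
  rw [Allowed, Allowed, and_assoc,
    show (t + u * (2 * h) + (s - u) * h : ZMod n) = t + s * h + u * h by ring]

theorem sum_Icc_eq_sum_dvd [NeZero n] (hd : d ∣ n) (f : ZMod n → ℕ) :
    ∑ i ∈ Finset.Icc 1 d, f ((i * (n / d) : ℕ) : ZMod n) =
      ∑ s with ((n / d : ℕ) : ZMod n) ∣ s, f s := by
  obtain ⟨e, rfl⟩ := hd
  have hd0 : d ≠ 0 := by rintro rfl; exact NeZero.ne (0 * e) (by simp)
  have he0 : e ≠ 0 := by rintro rfl; exact NeZero.ne (d * 0) (by simp)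
  rw [Nat.mul_div_cancel_left _ (Nat.pos_of_ne_zero hd0)]
  refine Finset.sum_nbij (fun i => ((i * e : ℕ) : ZMod (d * e))) ?_ ?_ ?_ fun _ _ => rfl
  · intro i _
    simp
  · intro i hi j hj hij
    simp only [Finset.coe_Icc, Set.mem_Icc] at hi hj
    have h1 := (Nat.ModEq.mul_right_cancel_iff' he0).1 ((ZMod.natCast_eq_natCast_iff _ _ _).1 hij)
    rcases lt_trichotomy i j with h | h | h
    · have := Nat.le_of_dvd (by omega) ((Nat.modEq_iff_dvd' h.le).1 h1); omega
    · exact h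
    · have := Nat.le_of_dvd (by omega) ((Nat.modEq_iff_dvd' h.le).1 h1.symm); omega
  · intro s hs
    simp only [Finset.coe_filter, Finset.mem_univ, true_and, Set.mem_ofPred_eq] at hs
    obtain ⟨x, rfl⟩ := hs
    obtain ⟨x, rfl⟩ := ZMod.natCast_zmod_surjective x
    have hcast : ∀ i : ℕ, i ≡ x [MOD d] →
        ((i * e : ℕ) : ZMod (d * e)) = (e : ZMod (d * e)) * (x : ZMod (d * e)) := fun i hi => by
      rw [← Nat.cast_mul, ZMod.natCast_eq_natCast_iff, mul_comm e]
      exact Nat.ModEq.mul_right' e hi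
    rcases Nat.eq_zero_or_pos (x % d) with h0 | h0
    -- The sum starts at `1`, so the zero class is represented by `i = d`.
    · refine ⟨d, by simp; omega, hcast d ?_⟩
      simp [Nat.ModEq, h0]
    · refine ⟨x % d, ?_, hcast _ (Nat.mod_modEq _ _)⟩
      simpa using ⟨h0, (Nat.mod_lt _ (Nat.pos_of_ne_zero hd0)).le⟩

theorem card_filter_dvd [NeZero n] (hd : d ∣ n) :
    (Finset.univ.filter fun s : ZMod n => ((n / d : ℕ) : ZMod n) ∣ s).card = d := by
  simpa using (sum_Icc_eq_sum_dvd hd fun _ => 1).symm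

open Classical in
-- Translation by one solution `u₀` identifies the solution set with the multiples of `n / gcd(m_a,
-- m_b)` in `ℤ/n`.
theorem card_filter_allowed [NeZero n] (hh : h ≠ 0) (ha : a ∣ n) (hb : b ∣ n) (t s : ZMod n) :
    (Finset.univ.filter fun u : ZMod n =>
        Allowed n h a t u ∧ Allowed n h b (t + u * (2 * h)) (s - u)).card =
      if Allowed n h (prodLabel n h a b) t s then
        Nat.gcd (Nat.gcd a (n * h / a)) (Nat.gcd b (n * h / b)) else 0 := by
  have hn := NeZero.ne n
  split_ifs with H
  · obtain ⟨u₀, h1, h2⟩ := (exists_allowed_iff hn hh ha hb t s).2 H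
    have hg : Nat.gcd (Nat.gcd a (n * h / a)) (Nat.gcd b (n * h / b)) ∣ n :=
      (Nat.gcd_dvd_left _ _).trans ((Nat.gcd_dvd_left _ _).trans ha)
    rw [← card_filter_dvd hg]
    refine (Finset.card_equiv (Equiv.addRight u₀) fun w => ?_).symm
    simp only [Finset.mem_filter, Finset.mem_univ, true_and, Equiv.coe_addRight]
    have hw : ((n / Nat.gcd (Nat.gcd a (n * h / a)) (Nat.gcd b (n * h / b)) : ℕ) : ZMod n) ∣ w ↔
        (((n / a : ℕ) : ZMod n) ∣ w ∧ (a : ZMod n) ∣ w * h ∧ ((n / b : ℕ) : ZMod n) ∣ w ∧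
          (b : ZMod n) ∣ w * h) := by
      obtain ⟨w, rfl⟩ := ZMod.intCast_surjective w
      have := dvd_and_dvd_mul_iff hn hh ha hb w
      simp only [← natCast_dvd_intCast_zmod_iff ha, ← natCast_dvd_intCast_zmod_iff hb,
        ← natCast_dvd_intCast_zmod_iff (Nat.div_dvd_of_dvd ha),
        ← natCast_dvd_intCast_zmod_iff (Nat.div_dvd_of_dvd hb),
        ← natCast_dvd_intCast_zmod_iff (Nat.div_dvd_of_dvd hg)] at this
      push_cast at this
      exact this.symm
    rw [hw, Allowed, Allowed, and_assoc,
      show t + (w + u₀) * h = w * h + (t + u₀ * h) by ring,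
      show s - (w + u₀) = (s - u₀) - w by ring,
      show t + (w + u₀) * (2 * h) + (s - u₀ - w) * h = w * h + (t + u₀ * (2 * h) + (s - u₀) * h)
        by ring, dvd_add_left h1.1, dvd_add_left h1.2, dvd_sub_right h2.1, dvd_add_left h2.2]
  · rw [Finset.card_eq_zero, Finset.filter_eq_empty_iff]
    exact fun u _ hu => H ((exists_allowed_iff hn hh ha hb t s).1 ⟨u, hu⟩)

end

/-! ### Rotations of weights -/

section
variable {N k : ℕ} [NeZero N]

theorem tau_iterate_apply (j : ℕ) (l : Weight N k) (i : ZMod N) :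
    (tau^[j] l).1 i = l.1 (i - j) := by
  induction j generalizing i with
  | zero => simp
  | succ j ih =>
    rw [Function.iterate_succ_apply']
    change (tau^[j] l).1 (i - 1) = _
    rw [ih]
    exact congrArg l.1 (by push_cast; ring)

theorem tau_iterate_congr {i j : ℕ} (hij : i ≡ j [MOD N]) (l : Weight N k) :
    tau^[i] l = tau^[j] l := by
  ext x
  rw [tau_iterate_apply, tau_iterate_apply, (ZMod.natCast_eq_natCast_iff i j N).2 hij]

theorem dual_dual (l : Weight N k) : dual (dual l) = l := by
  ext x
  simp [dual]

theorem dual_tau_iterate {i j : ℕ} (hij : N ∣ i + j) (l : Weight N k) :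
    dual (tau^[i] l) = tau^[j] (dual l) := by
  have h0 := (ZMod.natCast_eq_zero_iff (i + j) N).2 hij
  push_cast at h0
  ext x
  rw [tau_iterate_apply]
  change (tau^[i] l).1 (-x) = l.1 (-(x - j))
  rw [tau_iterate_apply]
  exact congrArg l.1 (by linear_combination -h0)

theorem grade_cast (l : Weight N k) : (grade l : ZMod N) = ∑ i, i * (l.1 i : ZMod N) := by
  simp [grade]

theorem sum_cast (l : Weight N k) : ∑ i, (l.1 i : ZMod N) = k := by
  rw [← Nat.cast_sum, l.2]

/-- Rotation by `j` raises the position of each of the `k` units of label by `j` modulo `N`. -/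
theorem grade_tau_iterate (j : ℕ) (l : Weight N k) :
    (grade (tau^[j] l) : ZMod N) = grade l + j * k := by
  rw [grade_cast, grade_cast, ← sum_cast l, Finset.mul_sum, ← Finset.sum_add_distrib]
  refine Fintype.sum_equiv (Equiv.subRight (j : ZMod N)) _ _ fun i => ?_
  rw [tau_iterate_apply, Equiv.subRight_apply]
  ring

theorem grade_dual (l : Weight N k) : (grade (dual l) : ZMod N) = -grade l := by
  rw [grade_cast, grade_cast, ← Finset.sum_neg_distrib]
  refine Fintype.sum_equiv (Equiv.neg (ZMod N)) _ _ fun i => ?_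
  change i * (l.1 (-i) : ZMod N) = -(-i * (l.1 (-i) : ZMod N))
  ring

end

/-! ### The modular invariants -/

section
variable {N k n h r : ℕ} [NeZero N]

/-- The power of `τ ^ r` indexed by a residue class modulo `n`. -/
def shift (r : ℕ) (s : ZMod n) (l : Weight N k) : Weight N k := tau^[r * s.val] l

theorem IsShiftData.shift_natCast (D : IsShiftData N k n h r) (i : ℕ) (l : Weight N k) :
    shift r (i : ZMod n) l = tau^[r * i] l := by
  refine tau_iterate_congr ?_ l
  rw [D.eq_mul, ZMod.val_natCast]
  exact Nat.ModEq.mul_left' r (Nat.mod_modEq _ _)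

theorem IsShiftData.shift_shift (D : IsShiftData N k n h r) (s u : ZMod n) (l : Weight N k) :
    shift r s (shift r u l) = shift r (u + s) l := by
  have := NeZero.mk D.ne_zero
  obtain ⟨i, rfl⟩ := ZMod.natCast_zmod_surjective s
  obtain ⟨j, rfl⟩ := ZMod.natCast_zmod_surjective u
  rw [← Nat.cast_add, D.shift_natCast, D.shift_natCast, D.shift_natCast,
    ← Function.iterate_add_apply, mul_add, add_comm]

theorem IsShiftData.dual_shift (D : IsShiftData N k n h r) (s : ZMod n) (l : Weight N k) :
    dual (shift r s l) = shift r (-s) (dual l) := by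
  have := NeZero.mk D.ne_zero
  refine dual_tau_iterate ?_ l
  rw [← mul_add, D.eq_mul]
  refine Nat.mul_dvd_mul_left r ((ZMod.natCast_eq_zero_iff _ _).1 ?_)
  simp

theorem IsShiftData.grade_shift (D : IsShiftData N k n h r) (s : ZMod n) (l : Weight N k) :
    (grade (shift r s l) : ZMod n) = grade l + s * (2 * h) := by
  have := NeZero.mk D.ne_zero
  have h1 := congrArg (ZMod.castHom D.dvd (ZMod n)) (grade_tau_iterate (r * s.val) l)
  simp only [map_natCast, map_add, map_mul] at h1
  have h2 := (ZMod.natCast_eq_natCast_iff _ _ _).2 D.two_mul_modEq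
  push_cast at h1 h2
  rw [shift, h1, h2, ZMod.natCast_zmod_val]
  ring

theorem IsShiftData.grade_dual (D : IsShiftData N k n h r) (l : Weight N k) :
    (grade (dual l) : ZMod n) = -grade l := by
  have h1 := congrArg (ZMod.castHom D.dvd (ZMod n)) (SLModInv.grade_dual l)
  simpa only [map_natCast, map_neg] using h1

open Classical in
theorem IsShiftData.zplus_apply [NeZero n] (D : IsShiftData N k n h r) {d : ℕ} (hd : d ∣ n)
    (l x : Weight N k) :
    Zplus N k d l x = ∑ s : ZMod n,
      if Allowed n h d (grade l) s ∧ x = shift r s l then 1 else 0 := by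
  have hd0 : 0 < d := Nat.pos_of_ne_zero (ne_zero_of_dvd_ne_zero D.ne_zero hd)
  have h1 := sum_Icc_eq_sum_dvd hd fun s : ZMod n =>
    if (d : ZMod n) ∣ grade l + s * h ∧ x = shift r s l then 1 else 0
  rw [Finset.sum_filter] at h1
  have h2 : ∀ s : ZMod n, (if ((n / d : ℕ) : ZMod n) ∣ s then
        if (d : ZMod n) ∣ grade l + s * h ∧ x = shift r s l then 1 else 0 else 0) =
      if Allowed n h d (grade l) s ∧ x = shift r s l then 1 else 0 := fun s => by
    simp only [← ite_and, Allowed, and_assoc]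
  rw [Finset.sum_congr rfl fun s _ => h2 s] at h1
  rw [← h1, Zplus, Matrix.of_apply]
  refine Finset.sum_congr rfl fun i _ => ?_
  have e1 : N * i * kHat N k / (2 * d) = i * (n / d) * h := by
    obtain ⟨e, rfl⟩ := hd
    rw [Nat.mul_div_cancel_left _ hd0]
    refine Nat.div_eq_of_eq_mul_left (by positivity) ?_
    rw [mul_right_comm, D.mul_kHat]
    ring
  have e2 : i * (N / d) = r * (i * (n / d)) := by
    rw [mul_left_comm, ← Nat.mul_div_assoc _ hd, ← D.eq_mul]
  have e3 : (d : ZMod n) ∣ grade l + ((i * (n / d) : ℕ) : ZMod n) * h ↔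
      d ∣ grade l + i * (n / d) * h := by
    rw [← Int.natCast_dvd_natCast, ← natCast_dvd_intCast_zmod_iff hd, Int.cast_natCast,
      Nat.cast_add, Nat.cast_mul _ h]
  rw [e1, e2, D.shift_natCast, ite_zero_mul_ite_zero, mul_one]
  simp only [e3]

/-- Each pair of shifts `(u, v)` determines the intermediate weight; grouping the pairs by `s = u +
v` reduces the product to the count of admissible `u`. Indexing by shifts rather than by weights
keeps this valid when a rotation fixes a weight. -/
theorem IsShiftData.zplus_mul_zplus (D : IsShiftData N k n h r) {a b : ℕ} (ha : a ∣ n)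
    (hb : b ∣ n) : Zplus N k a * Zplus N k b =
      Nat.gcd (mOf N k a) (mOf N k b) • Zplus N k (prodLabel n h a b) := by
  classical
  have := NeZero.mk D.ne_zero
  ext l x
  have hsplit : ∀ y, Zplus N k a l y * Zplus N k b y x = ∑ u : ZMod n, ∑ v : ZMod n,
      if y = shift r u l then
        if Allowed n h a (grade l) u ∧ Allowed n h b (grade l + u * (2 * h)) v ∧
          x = shift r (u + v) l then 1 else 0
      else 0 := fun y => by
    rw [D.zplus_apply ha, D.zplus_apply hb, Finset.sum_mul_sum]
    refine Finset.sum_congr rfl fun u _ => Finset.sum_congr rfl fun v _ => ?_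
    by_cases hy : y = shift r u l
    · subst hy
      rw [D.grade_shift, D.shift_shift, ite_zero_mul_ite_zero]
      simp only [and_true, if_true, mul_one]
    · simp [hy]
  have hcount : ∀ s : ZMod n, (∑ u : ZMod n,
      if Allowed n h a (grade l) u ∧ Allowed n h b (grade l + u * (2 * h)) (s - u) ∧
        x = shift r s l then 1 else 0) = Nat.gcd (mOf N k a) (mOf N k b) *
      if Allowed n h (prodLabel n h a b) (grade l) s ∧ x = shift r s l then 1 else 0 :=
      fun s => by
    have := card_filter_allowed D.shift_ne_zero ha hb (grade l : ZMod n) s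
    rw [← D.mOf_eq a ha, ← D.mOf_eq b hb, Finset.card_filter] at this
    by_cases hx : x = shift r s l
    · simp only [hx, and_true, this]
      simp
    · simp [hx]
  rw [Matrix.mul_apply, Matrix.smul_apply, D.zplus_apply (prodLabel_dvd ha hb), smul_eq_mul,
    Finset.mul_sum, ← Finset.sum_congr rfl fun s _ => hcount s,
    Finset.sum_congr rfl fun y _ => hsplit y, Finset.sum_comm]
  conv_rhs => rw [Finset.sum_comm]
  refine Finset.sum_congr rfl fun u _ => ?_
  rw [Finset.sum_comm]
  refine Fintype.sum_equiv (Equiv.addLeft u) _ _ fun v => ?_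
  simp

theorem zminus_apply (l x : Weight N k) : Zminus N k l x = if dual l = x then 1 else 0 := by
  have : l = dual x ↔ dual l = x :=
    ⟨fun e => by rw [e, dual_dual], fun e => by rw [← e, dual_dual]⟩
  simp only [Zminus, Matrix.of_apply, this]

theorem zminus_sq : Zminus N k ^ 2 = Zplus N k 1 := by
  ext l x
  have hN : tau^[N] l = l := tau_iterate_congr (j := 0) (by simp [Nat.ModEq]) l
  have h1 : (Zminus N k ^ 2) l x = if l = x then 1 else 0 := by
    simp only [sq, Matrix.mul_apply, zminus_apply, ite_mul, one_mul, zero_mul, Finset.sum_ite_eq,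
      Finset.mem_univ, if_true, dual_dual]
  rw [h1, Zplus, Matrix.of_apply, Finset.Icc_self, Finset.sum_singleton]
  simp [hN, eq_comm]

theorem IsShiftData.zminus_mul_zplus (D : IsShiftData N k n h r) {d : ℕ} (hd : d ∣ n) :
    Zminus N k * Zplus N k d = Zplus N k d * Zminus N k := by
  classical
  have := NeZero.mk D.ne_zero
  ext l x
  have h1 : (Zminus N k * Zplus N k d) l x = Zplus N k d (dual l) x := by
    simp [Matrix.mul_apply, zminus_apply]
  have h2 : (Zplus N k d * Zminus N k) l x = Zplus N k d l (dual x) := by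
    simp [Matrix.mul_apply, Zminus]
  rw [h1, h2, D.zplus_apply hd, D.zplus_apply hd]
  -- Duality reverses the direction of rotation, so the shift `s` of the dual weight matches `-s` of
  -- the original.
  refine Fintype.sum_equiv (Equiv.neg _) _ _ fun s => ?_
  have e : dual x = shift r (-s) l ↔ x = shift r s (dual l) := by
    constructor
    · intro e; rw [← dual_dual x, e, D.dual_shift, neg_neg]
    · rintro rfl; rw [D.dual_shift, dual_dual]
  simp only [Equiv.neg_apply, e, D.grade_dual, ← allowed_neg_neg (t := -(grade l : ZMod n)), neg_neg]

end
end SLModInv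

theorem proposition4p5 (N k : ℕ) [NeZero N] (hN : 2 ≤ N) (hk : 1 ≤ k) :
    SLModInv.Zminus N k ^ 2 = SLModInv.Zplus N k 1 ∧
    (∀ d : ℕ, SLModInv.Admissible N k d →
      SLModInv.Zminus N k * SLModInv.Zplus N k d = SLModInv.Zplus N k d * SLModInv.Zminus N k) ∧
    (∀ d' d'' : ℕ, SLModInv.Admissible N k d' → SLModInv.Admissible N k d'' →
      (∃! d : ℕ, SLModInv.IsProductLabel N k d' d'' d) ∧
      ∀ d : ℕ, SLModInv.IsProductLabel N k d' d'' d →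
        SLModInv.Zplus N k d' * SLModInv.Zplus N k d'' =
          SLModInv.Zplus N k d'' * SLModInv.Zplus N k d' ∧
        SLModInv.Zplus N k d'' * SLModInv.Zplus N k d' =
          Nat.gcd (SLModInv.mOf N k d') (SLModInv.mOf N k d'') • SLModInv.Zplus N k d) := by
  obtain ⟨n, h, r, D⟩ := SLModInv.exists_isShiftData (by omega : N ≠ 0) hk
  refine ⟨SLModInv.zminus_sq, fun d hd => D.zminus_mul_zplus ((D.admissible_iff d).1 hd),
    fun a b ha hb => ?_⟩
  rw [D.admissible_iff] at ha hb
  simp only [D.isProductLabel_iff ha hb]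
  refine ⟨⟨_, rfl, fun _ h => h⟩, ?_⟩
  rintro _ rfl
  rw [D.zplus_mul_zplus ha hb, D.zplus_mul_zplus hb ha, SLModInv.prodLabel_comm (a := b),
    Nat.gcd_comm (SLModInv.mOf N k b)]
  exact ⟨rfl, rfl⟩
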